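/- Stochastic bandit with strategic arms. There are $K\ge 2$ arms; arm $i$ has a reward distribution $\nu_i$ on $\mathbb R$ with mean $\mu_i$ that is $\sigma$-sub-Gaussian, i.e. $\mathbb E[e^{s(X-\mu_i)}]\le e^{\sigma^2s^2/2}$ for all $s\in\mathbb R$, where $\sigma>0$ is known. The optimal arm $i^*=\arg\max_i\mu_i$ is unique; put $\Delta_i=\mu_{i^*}-\mu_i$ and $\Delta_{\min}=\min_{i\ne i^*}\Delta_i>0$. In rounds $t=1,\dots,T$ the principal pulls an arm $I_t$, which generates a true reward $r_t\sim\nu_{I_t}$, independently of the past. The pulled arm $i$ adds a manipulation $\alpha_t$ and the principal sees only $I_t$ and $r_t+\alpha_t$. Arm $i$ has a budget $B_i\ge 0$, with $B_{i^*}=0$, and every arm uses Lump Sum Investing: whenever it is pulled it adds its whole remaining budget, so that it spends $B_i$ at its first pull and nothing later. Let $n_i(t)$ be the number of pulls of arm $i$ in the first $t$ rounds and $\widetilde\mu_i(t)$ the average of the manipulated rewards of these pulls. The regret is $R(T)=\sum_{t=1}^T(\mu_{i^*}-r_t)$, measured with the true rewards. The principal pulls each arm once in rounds $1,\dots,K$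 and in rounds $t>K$ uses one of the following rules (ties in an $\arg\max$ are broken by any fixed measurable rule). - $\varepsilon$-Greedy: with probability $\varepsilon_t=\min\{1,cK/t\}$, where $c=\max\{20,36\sigma^2/\Delta_{\min}\}$, pull a uniformly random arm; otherwise pull $\arg\max_i\widetilde\mu_i(t-1)$. - Gaussian Thompson Sampling: sample independently $\theta_i\sim\mathcal N\big(\widetilde\mu_i(t-1),\,1/n_i(t-1)\big)$ and pull $\arg\max_i\theta_i$. Then for all $K\ge2$, $\sigma>0$ and $M$ there is a constant $C$, depending only on $K$, $\sigma$ and $M$, such that for both algorithms, all $\sigma$-sub-Gaussian reward distributions as above with $\Delta_{\min}\le M$, all budgets and all $T\ge2$ with $\sum_{i\ne i^*}\frac{B_i}{2\Delta_i}\le T$, the regret is integrable and $$\mathbb E[R(T)]\ \ge\ \Delta_{\min}\sum_{i\ne i^*}\frac{B_i}{2\Delta_i}\ -\ C\,\frac{\ln T}{\Delta_{\min}}.$$ -/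

import Mathlib

open MeasureTheory ProbabilityTheory
open scoped NNReal

noncomputable section

namespace StrategicBandit

/-- What happens in one round: the round number (rounds are numbered from 1), the pulled arm, the
true reward `r` and the manipulation `α` which the pulled arm adds to it. -/
structure Round (K : ℕ) where
  time : ℕ
  arm : Fin K
  reward : ℝ
  manip : ℝ

/-- What the principal sees of the past: the pulled arms and the manipulated rewards `r + α`, one
entry per round, the most recent round first. -/
abbrev Revealed (K : ℕ) := List (Fin K × ℝ)

/-- What an arm sees of the past: for each round in which this arm was pulled, the round number, its
true reward and its own manipulation, the most recent round first. -/
abbrev OwnHistory := List (ℕ × ℝ × ℝ)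

/-- An adaptive manipulation strategy of an arm: the amount that it adds to its reward when it is
pulled, as a function of its own history (in the other rounds its manipulation is zero). -/
abbrev Strategy := OwnHistory → ℝ

/-- Lump sum investing with budget `b`: whenever pulled, spend the whole remaining budget. -/
def lsi (b : ℝ) : Strategy := fun h => b - (h.map fun e => e.2.2).sum

/-- A (randomized) bandit algorithm: the arm that is pulled next, as a function of what the principal
has seen and of a fresh random seed. -/
abbrev Principal (K : ℕ) (Seed : Type) := Revealed K → Seed → Fin K

/-- `n_i`: how often arm `i` has been pulled. -/
def pulls {K : ℕ} (h : Revealed K) (i : Fin K) : ℕ := h.countP fun e => e.1 = i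

/-- The average manipulated reward of arm `i`, that is, `μ̂_i + β_i / n_i` with `μ̂_i` the average
true reward and `β_i` the total manipulation of arm `i` so far. -/
def modMean {K : ℕ} (h : Revealed K) (i : Fin K) : ℝ :=
  ((h.filter fun e => e.1 = i).map Prod.snd).sum / pulls h i

/-- The principal's view of a history. -/
def revealed {K : ℕ} (h : List (Round K)) : Revealed K := h.map fun x => (x.arm, x.reward + x.manip)

/-- Arm `i`'s view of a history. -/
def own {K : ℕ} (h : List (Round K)) (i : Fin K) : OwnHistory :=
  (h.filter fun x => x.arm = i).map fun x => (x.time, x.reward, x.manip)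

/-- The history of the first `t` rounds (the most recent first) when the principal uses the algorithm
`A` with seeds `ξ` and arm `i` uses the strategy `S i`; `X (i, s)` is the true reward of the pull of
arm `i` that comes after `s` earlier pulls of this arm. -/
def run {K : ℕ} {Seed : Type} (A : Principal K Seed) (S : Fin K → Strategy)
    (X : Fin K × ℕ → ℝ) (ξ : ℕ → Seed) : ℕ → List (Round K)
  | 0 => []
  | t + 1 =>
    let h := run A S X ξ t
    let i := A (revealed h) (ξ t)
    { time := t + 1, arm := i, reward := X (i, pulls (revealed h) i), manip := S i (own h i) } :: h

/-- The joint law of all rewards and seeds: everything is independent, the rewards of arm `i` have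
the distribution `ν i` and the seeds have the distribution `ρ`. -/
def law {K : ℕ} {Seed : Type} [MeasurableSpace Seed] (ν : Fin K → Measure ℝ) (ρ : Measure Seed) :
    Measure ((Fin K × ℕ → ℝ) × (ℕ → Seed)) :=
  (Measure.infinitePi fun p : Fin K × ℕ => ν p.1).prod (Measure.infinitePi fun _ : ℕ => ρ)

/-- The mean reward of arm `i`. -/
def mean {K : ℕ} (ν : Fin K → Measure ℝ) (i : Fin K) : ℝ := ∫ x, x ∂(ν i)

/-- `Δ_i`. -/
def gap {K : ℕ} (ν : Fin K → Measure ℝ) (istar i : Fin K) : ℝ := mean ν istar - mean ν i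

/-- `Δ_min`, the minimum of `Δ_i` over the arms `i ≠ i*`. -/
def minGap {K : ℕ} (ν : Fin K → Measure ℝ) (istar : Fin K) : ℝ :=
  ⨅ i : {i : Fin K // i ≠ istar}, gap ν istar i

/-- The regret of the first `T` rounds with respect to the true rewards, `∑_{t ≤ T} (μ_{i*} - r_t)`,
as a random variable. -/
def regret {K : ℕ} {Seed : Type} (ν : Fin K → Measure ℝ) (istar : Fin K) (A : Principal K Seed)
    (S : Fin K → Strategy) (T : ℕ) (ω : (Fin K × ℕ → ℝ) × (ℕ → Seed)) : ℝ :=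
  ((run A S ω.1 ω.2 T).map fun x => mean ν istar - x.reward).sum

/-- A rule that picks, in each round, a maximizer of an index over the arms (with some fixed,
measurable way of breaking ties). -/
structure IsArgmaxRule {K : ℕ} (sel : ℕ → (Fin K → ℝ) → Fin K) : Prop where
  measurable : ∀ t, Measurable (sel t)
  le_sel : ∀ (t : ℕ) (v : Fin K → ℝ) (j : Fin K), v j ≤ v (sel t v)

/-- The `ε`-greedy algorithm. Rounds `1, …, K` pull each arm once. In a later round `t` the seed is a
coin `u`, uniform on `[0, 1]`, and an independent uniformly drawn arm: explore, by pulling the drawn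
arm, if `u < ε_t`; otherwise exploit. -/
def epsGreedy {K : ℕ} (ε : ℕ → ℝ) (sel : ℕ → (Fin K → ℝ) → Fin K) : Principal K (ℝ × Fin K) :=
  fun h ξ =>
    if hK : h.length < K then ⟨h.length, hK⟩
    else if ξ.1 < ε (h.length + 1) then ξ.2
    else sel (h.length + 1) (modMean h)

/-- The law of the seeds of the `ε`-greedy algorithm. -/
def epsGreedySeed (K : ℕ) : Measure (ℝ × Fin K) :=
  (volume.restrict (Set.Icc (0 : ℝ) 1)).prod (uniformOn (Set.univ : Set (Fin K)))

/-- `ε_t = min {1, c K / t}` with `c = max {20, 36 σ² / Δ_min}`. -/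
def epsSchedule (K : ℕ) (σ Δmin : ℝ) (t : ℕ) : ℝ :=
  min 1 (max 20 (36 * σ ^ 2 / Δmin) * K / t)

/-- Gaussian Thompson sampling. Rounds `1, …, K` pull each arm once. In a later round the seed is a
vector `z` of independent standard Gaussians, so that `θ_i = modMean h i + z i / √n_i` are independent
with law `N(modMean h i, 1 / n_i)` given the past; an arm with the largest `θ_i` is pulled. -/
def thompson {K : ℕ} (sel : ℕ → (Fin K → ℝ) → Fin K) : Principal K (Fin K → ℝ) :=
  fun h z =>
    if hK : h.length < K then ⟨h.length, hK⟩
    else sel (h.length + 1) fun i => modMean h i + z i / √(pulls h i : ℝ)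

/-- The law of the seeds of Gaussian Thompson sampling. -/
def thompsonSeed (K : ℕ) : Measure (Fin K → ℝ) := Measure.pi fun _ => gaussianReal 0 1

end StrategicBandit

end

open StrategicBandit

/-! After `n` pulls, lump sum investing raises the average of arm `i` by `B i / n`. Put `N_i = B i /
(2 Δ_i)`. As long as `n < N_i` the bonus exceeds `2 Δ_i`, so the arm looks better than the optimal
one by about `Δ_i`. Let `L = 64 (σ + 1)² ln T / Δ_min²`. If all deviations are typical, `N_i ≥ L`
and the optimal arm already has `L` pulls, noise cannot reverse this order (`index_lt`). So if some
such arm never reaches `N_i` pulls, the optimal arm is pulled only about `L` times plus initial and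
exploring rounds (`counts_istar_le`), and the other arms share the rest of the `T ≥ ∑ N_i` rounds.
If no such arm exists, every suboptimal arm has at least `N_i - L` pulls. Either way the suboptimal
pulls number `∑ N_i` up to a logarithmic loss and the explorations (`le_suboptimal_pulls`).

A Wald-type identity turns expected regret into the expectation of `∑ Δ_i n_i`
(`IsPerturbedGreedy.integral_regret`). Atypical outcomes have probability at most `4K / T`
(`measureReal_not_typical_le`) and cost at most `T` pulls each.

Both algorithms are perturbed greedy policies: `ε`-greedy explores and has no noise, Thompson
sampling has Gaussian noise of scale `1 / √n` and never explores. One bound,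
`IsPerturbedGreedy.le_integral_regret`, serves both. -/

namespace StrategicBandit

/-! ### Reduction of the run to the numbers of pulls -/

section Counts

variable {K : ℕ} {Seed : Type}

/-- A policy that depends on the past only through its length, the average manipulated rewards and
the numbers of pulls. -/
abbrev Policy (K : ℕ) (Seed : Type) :=
  ℕ → (Fin K → ℝ) → (Fin K → ℕ) → Seed → Fin K

/-- The principal that follows a policy. -/
noncomputable def Policy.principal (F : Policy K Seed) : Principal K Seed :=
  fun h z => F h.length (modMean h) (pulls h) z

/-- The average manipulated reward of arm `i` after `n` pulls under lump sum investing. -/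
noncomputable def lumpMean (b : ℝ) (x : ℕ → ℝ) (n : ℕ) : ℝ :=
  -- For `n = 0` the value is `0 / 0 = 0`, which agrees with `modMean` of an arm not yet pulled.
  (∑ s ∈ Finset.range n, x s + if n = 0 then 0 else b) / n

/-- The numbers of pulls after `t` rounds when every arm uses lump sum investing. -/
noncomputable def counts (F : Policy K Seed) (B : Fin K → ℝ) (X : Fin K × ℕ → ℝ) (ξ : ℕ → Seed) :
    ℕ → Fin K → ℕ
  | 0 => 0
  | t + 1 =>
    let n := counts F B X ξ t
    n + Pi.single (F t (fun i => lumpMean (B i) (fun s => X (i, s)) (n i)) n (ξ t)) 1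

/-- The arm pulled in round `t + 1` when every arm uses lump sum investing. -/
noncomputable def pulledArm (F : Policy K Seed) (B : Fin K → ℝ) (X : Fin K × ℕ → ℝ) (ξ : ℕ → Seed) (t : ℕ) :
    Fin K :=
  F t (fun i => lumpMean (B i) (fun s => X (i, s)) (counts F B X ξ t i)) (counts F B X ξ t) (ξ t)

variable (F : Policy K Seed) (B : Fin K → ℝ) (X : Fin K × ℕ → ℝ) (ξ : ℕ → Seed)

@[simp] lemma counts_zero (i : Fin K) : counts F B X ξ 0 i = 0 := rfl

lemma counts_succ (t : ℕ) (i : Fin K) :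
    counts F B X ξ (t + 1) i =
      counts F B X ξ t i + if pulledArm F B X ξ t = i then 1 else 0 := by
  change _ + Pi.single (M := fun _ : Fin K => ℕ) (pulledArm F B X ξ t) 1 i = _
  simp [Pi.single_apply, eq_comm]

lemma sum_counts (t : ℕ) : ∑ i, counts F B X ξ t i = t := by
  induction t with
  | zero => simp
  | succ t ih => simp [counts_succ, Finset.sum_add_distrib, ih]

lemma counts_le (t : ℕ) (i : Fin K) : counts F B X ξ t i ≤ t :=
  (Finset.single_le_sum (f := counts F B X ξ t) (fun _ _ => Nat.zero_le _)
    (Finset.mem_univ i)).trans_eq (sum_counts F B X ξ t)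

lemma counts_mono (i : Fin K) : Monotone fun t => counts F B X ξ t i :=
  monotone_nat_of_le_succ fun t => by simp [counts_succ]

@[simp] lemma length_run (A : Principal K Seed) (S : Fin K → Strategy) (t : ℕ) :
    (run A S X ξ t).length = t := by
  induction t with
  | zero => rfl
  | succ t ih => simp [run, ih]

/-- The history is arbitrary so that the lemma applies inside the induction of `run_summary`, where
the hypotheses are the induction hypothesis. -/
lemma principal_revealed_of_eq {h : List (Round K)} {t : ℕ} (hl : h.length = t)
    (hp : ∀ i, pulls (revealed h) i = counts F B X ξ t i)
    (hm : ∀ i, (((revealed h).filter fun e => e.1 = i).map Prod.snd).sum =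
      ∑ s ∈ Finset.range (counts F B X ξ t i), X (i, s) +
        (if counts F B X ξ t i = 0 then 0 else B i)) :
    F.principal (revealed h) (ξ t) = pulledArm F B X ξ t := by
  have h1 : pulls (revealed h) = counts F B X ξ t := funext hp
  have h2 : modMean (revealed h) =
      fun i => lumpMean (B i) (fun s => X (i, s)) (counts F B X ξ t i) := by
    funext i
    rw [modMean, hp, hm, lumpMean]
  simp only [Policy.principal, h1, h2, pulledArm]
  simp [revealed, hl]

/-- The quantities of the run which enter the decisions, expressed by the numbers of pulls. -/
lemma run_summary (t : ℕ) (i : Fin K) :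
    pulls (revealed (run F.principal (fun i => lsi (B i)) X ξ t)) i = counts F B X ξ t i ∧
    (((revealed (run F.principal (fun i => lsi (B i)) X ξ t)).filter
      fun e => e.1 = i).map Prod.snd).sum =
        ∑ s ∈ Finset.range (counts F B X ξ t i), X (i, s) +
          (if counts F B X ξ t i = 0 then 0 else B i) ∧
    -- This part makes the induction close: the amount spent so far determines what `lsi` adds next.
    ((own (run F.principal (fun i => lsi (B i)) X ξ t) i).map fun e => e.2.2).sum =
      if counts F B X ξ t i = 0 then 0 else B i := by
  induction t generalizing i with
  | zero => simp [run, revealed, own, pulls]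
  | succ t ih =>
    have harm : F.principal (revealed (run F.principal (fun i => lsi (B i)) X ξ t)) (ξ t) =
        pulledArm F B X ξ t :=
      principal_revealed_of_eq F B X ξ (length_run X ξ _ _ t) (fun i => (ih i).1)
        fun i => (ih i).2.1
    obtain ⟨h1, h2, h3⟩ := ih i
    simp only [run, harm, counts_succ]
    by_cases hi : pulledArm F B X ξ t = i
    · subst hi
      simp only [pulls, revealed, own, lsi, List.map_cons, decide_true, List.countP_cons_of_pos,
        List.filter_cons_of_pos, List.sum_cons, if_true, Nat.add_eq_zero_iff, one_ne_zero,
        and_false, if_false] at h1 h2 h3 ⊢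
      rw [h1, h2, h3, Finset.sum_range_succ]
      refine ⟨rfl, ?_, ?_⟩ <;> ring
    · simp only [pulls, revealed, own, lsi, List.map_cons, hi, decide_false,
        if_false, add_zero, List.countP_cons, List.filter_cons, Bool.false_eq_true] at h1 h2 h3 ⊢
      exact ⟨h1, h2, h3⟩

lemma principal_revealed_run (t : ℕ) :
    F.principal (revealed (run F.principal (fun i => lsi (B i)) X ξ t)) (ξ t) =
      pulledArm F B X ξ t :=
  principal_revealed_of_eq F B X ξ (length_run X ξ _ _ t)
    (fun i => (run_summary F B X ξ t i).1) fun i => (run_summary F B X ξ t i).2.1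

/-- Rewards are tabulated by pull number, so the rounds can be regrouped by arm; this prepares the
Wald-type identity. -/
lemma regret_eq (ν : Fin K → Measure ℝ) (istar : Fin K) (T : ℕ) :
    regret ν istar F.principal (fun i => lsi (B i)) T (X, ξ) =
      ∑ i, ∑ s ∈ Finset.range (counts F B X ξ T i), (mean ν istar - X (i, s)) := by
  induction T with
  | zero => simp [regret, run]
  | succ t ih =>
    have step : ∀ i, ∑ s ∈ Finset.range (counts F B X ξ (t + 1) i), (mean ν istar - X (i, s)) =
        ∑ s ∈ Finset.range (counts F B X ξ t i), (mean ν istar - X (i, s)) +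
          if pulledArm F B X ξ t = i then
            mean ν istar - X (i, counts F B X ξ t i) else 0 := by
      intro i
      rw [counts_succ]
      split_ifs with h
      · rw [Finset.sum_range_succ]
      · simp
    simp only [step, Finset.sum_add_distrib, ← ih, Finset.sum_ite_eq, Finset.mem_univ, if_true]
    simp only [regret, run, List.map_cons, List.sum_cons, principal_revealed_run,
      (run_summary F B X ξ t _).1]
    ring

/-- Whether arm `i` is pulled more than `s` times does not depend on its reward number `s`. -/
lemma lt_counts_congr {X X' : Fin K × ℕ → ℝ} {i : Fin K} {s : ℕ}
    (h : ∀ p, p ≠ (i, s) → X p = X' p) (t : ℕ) :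
    (counts F B X ξ t = counts F B X' ξ t ∧ counts F B X ξ t i ≤ s) ∨
      (s < counts F B X ξ t i ∧ s < counts F B X' ξ t i) := by
  induction t with
  | zero => exact Or.inl ⟨rfl, Nat.zero_le _⟩
  | succ t ih =>
    rcases ih with ⟨heq, hle⟩ | ⟨h1, h2⟩
    -- A decision reads only the rewards of earlier pulls. While arm `i` has at most `s` pulls,
    -- reward `(i, s)` is not among them, so both runs agree.
    · have harm : pulledArm F B X ξ t = pulledArm F B X' ξ t := by
        have : (fun j => lumpMean (B j) (fun s => X (j, s)) (counts F B X ξ t j)) =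
            fun j => lumpMean (B j) (fun s => X' (j, s)) (counts F B X ξ t j) := by
          funext j
          simp only [lumpMean]
          congr 2
          refine Finset.sum_congr rfl fun k hk => h _ fun hjk => ?_
          obtain ⟨rfl, rfl⟩ := Prod.mk.inj hjk
          exact absurd (Finset.mem_range.1 hk) (not_lt.2 hle)
        simp only [pulledArm, ← heq, this]
      have hs : counts F B X ξ (t + 1) = counts F B X' ξ (t + 1) := by
        funext j
        rw [counts_succ, counts_succ, harm, heq]
      rcases le_or_gt (counts F B X ξ (t + 1) i) s with h' | h'
      · exact Or.inl ⟨hs, h'⟩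
      · exact Or.inr ⟨h', hs ▸ h'⟩
    · exact Or.inr ⟨h1.trans_le (counts_mono F B X ξ i t.le_succ),
        h2.trans_le (counts_mono F B X' ξ i t.le_succ)⟩

lemma lt_counts_iff {X X' : Fin K × ℕ → ℝ} {i : Fin K} {s : ℕ}
    (h : ∀ p, p ≠ (i, s) → X p = X' p) (t : ℕ) :
    s < counts F B X ξ t i ↔ s < counts F B X' ξ t i := by
  rcases lt_counts_congr F B ξ h t with ⟨h1, -⟩ | ⟨h1, h2⟩
  · rw [h1]
  · simp [h1, h2]

end Counts

/-! ### Perturbed greedy policies on typical outcomes -/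

section Greedy

variable {K : ℕ} {Seed : Type} [MeasurableSpace Seed]

/-- A policy that pulls every arm once and then, unless the seed lies in the exploration set,
maximizes the average manipulated reward plus a noise of scale `1 / √n`. -/
structure IsPerturbedGreedy (F : Policy K Seed) (explore : ℕ → Set Seed)
    (w : Seed → Fin K → ℝ) : Prop where
  measurable : ∀ t n, Measurable fun p : (Fin K → ℝ) × Seed => F t p.1 n p.2
  measurable_noise : Measurable w
  measurableSet_explore : ∀ t, MeasurableSet (explore t)
  init : ∀ t (h : t < K) m n z, F t m n z = ⟨t, h⟩
  le_index : ∀ t m n z, K ≤ t → z ∉ explore t → ∀ j,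
    m j + w z j / √(n j : ℝ) ≤ m (F t m n z) + w z (F t m n z) / √(n (F t m n z) : ℝ)

variable {F : Policy K Seed} {explore : ℕ → Set Seed} {w : Seed → Fin K → ℝ}

lemma IsPerturbedGreedy.one_le_counts (hF : IsPerturbedGreedy F explore w) (B : Fin K → ℝ)
    (X : Fin K × ℕ → ℝ) (ξ : ℕ → Seed) {t : ℕ} {i : Fin K} (h : i.val < t) :
    1 ≤ counts F B X ξ t i := by
  refine le_trans ?_ (counts_mono F B X ξ i (Nat.succ_le_of_lt h))
  have : pulledArm F B X ξ i = i := hF.init i i.2 _ _ _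
  simp [counts_succ, this]

/-- An arm whose lump sum is not used up yet has a larger index than the optimal arm, once the
latter has been pulled often. -/
lemma index_lt {σ ℓ d δ N μ μ' a a' z z' : ℝ} {s n : ℕ} (hσ : 0 ≤ σ) (hℓ : 0 ≤ ℓ) (hd : 0 < d)
    (hdδ : d ≤ δ) (hμ : μ' - μ = δ) (hs : 1 ≤ s) (hn : 1 ≤ n) (hsN : s < N)
    (hLN : 64 * (σ + 1) ^ 2 * ℓ / d ^ 2 ≤ N) (hLn : 64 * (σ + 1) ^ 2 * ℓ / d ^ 2 ≤ n)
    (ha : |a - s * μ| ≤ 2 * σ * √(s * ℓ)) (ha' : |a' - n * μ'| ≤ 2 * σ * √(n * ℓ))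
    (hz : |z| ≤ 2 * √ℓ) (hz' : |z'| ≤ 2 * √ℓ) :
    a' / n + z' / √(n : ℝ) < (a + 2 * N * δ) / s + z / √(s : ℝ) := by
  have hs0 : (0 : ℝ) < s := by exact_mod_cast hs
  have hn0 : (0 : ℝ) < n := by exact_mod_cast hn
  have hN0 : 0 < N := hs0.trans hsN
  -- The constant 64 is chosen for this: reward and noise deviations together, `2 (σ + 1) √(m ℓ)`,
  -- are at most `m d / 4` once `m ≥ L`.
  have key : ∀ m : ℝ, 0 ≤ m → 64 * (σ + 1) ^ 2 * ℓ / d ^ 2 ≤ m →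
      8 * (σ + 1) * √(m * ℓ) ≤ m * d := by
    intro m hm h
    rw [div_le_iff₀ (by positivity)] at h
    refine (pow_le_pow_iff_left₀ (by positivity) (by positivity) two_ne_zero).1 ?_
    rw [mul_pow, Real.sq_sqrt (by positivity)]
    nlinarith [mul_le_mul_of_nonneg_left h hm]
  have conv : ∀ (m : ℝ) (z : ℝ), 0 < m → |z| ≤ 2 * √ℓ → |m * (z / √m)| ≤ 2 * √(m * ℓ) := by
    intro m z hm hz
    have : m * (z / √m) = √m * z := by
      have h0 : √m ≠ 0 := (Real.sqrt_pos.2 hm).ne'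
      field_simp
      rw [Real.sq_sqrt hm.le]
      ring
    rw [this, abs_mul, abs_of_nonneg (Real.sqrt_nonneg _), Real.sqrt_mul hm.le]
    nlinarith [Real.sqrt_nonneg m]
  have k1 := key N hN0.le hLN
  have k2 := key n hn0.le hLn
  have c1 := abs_le.1 (conv s z hs0 hz)
  have c2 := abs_le.1 (conv n z' hn0 hz')
  have b1 := abs_le.1 ha
  have b2 := abs_le.1 ha'
  -- Since `s` may be far below `L`, its deviation is measured against the threshold `N`, where
  -- `key` applies.
  have hmono : √((s : ℝ) * ℓ) ≤ √(N * ℓ) := Real.sqrt_le_sqrt (by gcongr)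
  have m1 : σ * √((s : ℝ) * ℓ) ≤ σ * √(N * ℓ) := by gcongr
  have upper : n * (a' / n + z' / √(n : ℝ)) ≤ n * (μ' + d / 4) := by
    have : (n : ℝ) * (a' / n) = a' := by field_simp
    nlinarith
  have lower : s * (μ + (2 * N * δ - N * d / 4) / s) ≤ s * ((a + 2 * N * δ) / s + z / √(s : ℝ)) := by
    have h1 : (s : ℝ) * ((a + 2 * N * δ) / s) = a + 2 * N * δ := by field_simp
    have h2 : (s : ℝ) * ((2 * N * δ - N * d / 4) / s) = 2 * N * δ - N * d / 4 := by field_simp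
    rw [mul_add, mul_add, h1, h2]
    nlinarith
  have u := le_of_mul_le_mul_left upper hn0
  have l := le_of_mul_le_mul_left lower hs0
  refine u.trans_lt (lt_of_lt_of_le ?_ l)
  -- Uses `s < N` and `2δ - d/4 ≥ δ + d/4`, which follows from `d ≤ δ`.
  have : δ + d / 4 < (2 * N * δ - N * d / 4) / s := by
    rw [lt_div_iff₀ hs0]
    nlinarith
  linarith

/-- The number of exploring rounds among the first `T`. -/
noncomputable def explorations (explore : ℕ → Set Seed) (ξ : ℕ → Seed) (T : ℕ) : ℝ :=
  ∑ t ∈ Finset.range T, (explore t).indicator 1 (ξ t)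

omit [MeasurableSpace Seed] in
lemma explorations_nonneg (explore : ℕ → Set Seed) (ξ : ℕ → Seed) (T : ℕ) :
    0 ≤ explorations explore ξ T :=
  Finset.sum_nonneg fun _ _ => Set.indicator_nonneg (fun _ _ => zero_le_one) _

/-- All rewards and noises of the first `T` rounds deviate by at most the usual confidence width. -/
def Typical (ν : Fin K → Measure ℝ) (σ : ℝ) (w : Seed → Fin K → ℝ) (T : ℕ)
    (X : Fin K × ℕ → ℝ) (ξ : ℕ → Seed) : Prop :=
  (∀ i, ∀ s ∈ Finset.Icc 1 T,
    |∑ k ∈ Finset.range s, X (i, k) - s * mean ν i| ≤ 2 * σ * √(s * Real.log T)) ∧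
  ∀ t ∈ Finset.range T, ∀ i, |w (ξ t) i| ≤ 2 * √(Real.log T)

/-- While arm `i` is short of its threshold its index wins against an optimal arm with `L` pulls. So
each pull of the optimal arm is initial, exploring, or made when it has fewer than `L` pulls. -/
lemma counts_istar_le (hF : IsPerturbedGreedy F explore w) {ν : Fin K → Measure ℝ} {istar : Fin K}
    {σ d : ℝ} (hσ : 0 ≤ σ) (hd : 0 < d) (hgap : ∀ i, i ≠ istar → d ≤ gap ν istar i)
    {B : Fin K → ℝ} (hB : B istar = 0) {T : ℕ} {X : Fin K × ℕ → ℝ} {ξ : ℕ → Seed}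
    (hG : Typical ν σ w T X ξ) {i : Fin K} (hi : i ≠ istar)
    (hL : 64 * (σ + 1) ^ 2 * Real.log T / d ^ 2 ≤ B i / (2 * gap ν istar i))
    (hN : (counts F B X ξ T i : ℝ) < B i / (2 * gap ν istar i)) :
    (counts F B X ξ T istar : ℝ) ≤
      64 * (σ + 1) ^ 2 * Real.log T / d ^ 2 + K + 1 + explorations explore ξ T := by
  set L := 64 * (σ + 1) ^ 2 * Real.log T / d ^ 2
  have hℓ : 0 ≤ Real.log T := Real.log_natCast_nonneg T
  have hL0 : 0 ≤ L := by positivity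
  suffices ∀ t ≤ T, (counts F B X ξ t istar : ℝ) ≤ L + K + 1 + explorations explore ξ t from
    this T le_rfl
  intro t
  induction t with
  | zero =>
    intro _
    have := explorations_nonneg explore ξ 0
    simp only [counts_zero, Nat.cast_zero]
    positivity
  | succ t ih =>
    intro ht
    have ih := ih (by omega)
    have hE := explorations_nonneg explore ξ t
    have hE' : explorations explore ξ (t + 1) =
        explorations explore ξ t + (explore t).indicator 1 (ξ t) := Finset.sum_range_succ _ _
    have hind : 0 ≤ (explore t).indicator (1 : Seed → ℝ) (ξ t) :=
      Set.indicator_nonneg (fun _ _ => zero_le_one) _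
    by_cases hex : ξ t ∈ explore t
    · rw [hE', Set.indicator_of_mem hex, counts_succ]
      have : ((if pulledArm F B X ξ t = istar then 1 else 0 : ℕ) : ℝ) ≤ 1 := by
        split_ifs <;> simp
      push_cast at this ⊢
      simp only [Pi.one_apply]
      linarith
    by_cases hp : pulledArm F B X ξ t = istar
    swap
    · simp only [counts_succ, hp, if_false, add_zero]
      linarith
    by_cases htK : t < K
    · have h1 := counts_le F B X ξ (t + 1) istar
      have h2 : ((t + 1 : ℕ) : ℝ) ≤ K := by exact_mod_cast htK
      have h3 : (counts F B X ξ (t + 1) istar : ℝ) ≤ ((t + 1 : ℕ) : ℝ) := by exact_mod_cast h1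
      linarith
    push Not at htK
    have hs1 := hF.one_le_counts B X ξ (i.2.trans_le htK)
    have hn1 := hF.one_le_counts B X ξ (istar.2.trans_le htK)
    by_cases hLn : L ≤ counts F B X ξ t istar
    · exfalso
      have hδ := hgap i hi
      have hsT := (counts_le F B X ξ t i).trans (show t ≤ T by omega)
      have hnT := (counts_le F B X ξ t istar).trans (show t ≤ T by omega)
      have hmono : (counts F B X ξ t i : ℝ) ≤ counts F B X ξ T i := by
        exact_mod_cast counts_mono F B X ξ i (show t ≤ T by omega)
      have hlt := index_lt hσ hℓ hd hδ rfl hs1 hn1 (hmono.trans_lt hN) hL hLn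
        (hG.1 i _ (Finset.mem_Icc.2 ⟨hs1, hsT⟩)) (hG.1 istar _ (Finset.mem_Icc.2 ⟨hn1, hnT⟩))
        (hG.2 t (Finset.mem_range.2 (by omega)) i) (hG.2 t (Finset.mem_range.2 (by omega)) istar)
      have hidx := hF.le_index t
        (fun i => lumpMean (B i) (fun s => X (i, s)) (counts F B X ξ t i))
        (counts F B X ξ t) (ξ t) htK hex i
      rw [show F t _ _ (ξ t) = istar from hp] at hidx
      -- The bonus `2 N δ` of `index_lt` is exactly the budget when `N` is the threshold.
      have hb : 2 * (B i / (2 * gap ν istar i)) * gap ν istar i = B i := by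
        have : gap ν istar i ≠ 0 := (hd.trans_le hδ).ne'
        field_simp
      rw [hb] at hlt
      simp only [lumpMean, hB, (Nat.one_le_iff_ne_zero.1 hs1), (Nat.one_le_iff_ne_zero.1 hn1),
        if_false, add_zero] at hidx
      exact absurd hidx (not_le.2 hlt)
    · push Not at hLn
      simp only [counts_succ, hp, if_true]
      push_cast
      have : (0 : ℝ) ≤ K := Nat.cast_nonneg K
      linarith

/-- A lower bound for the number of pulls of suboptimal arms. -/
lemma le_suboptimal_pulls (hF : IsPerturbedGreedy F explore w) {ν : Fin K → Measure ℝ}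
    {istar : Fin K} {σ d : ℝ} (hσ : 0 ≤ σ) (hd : 0 < d)
    (hgap : ∀ i, i ≠ istar → d ≤ gap ν istar i)
    {B : Fin K → ℝ} (hB : B istar = 0) {T : ℕ} {X : Fin K × ℕ → ℝ} {ξ : ℕ → Seed}
    (hG : Typical ν σ w T X ξ)
    (hT : ∑ i ∈ Finset.univ.erase istar, B i / (2 * gap ν istar i) ≤ T) :
    ∑ i ∈ Finset.univ.erase istar, B i / (2 * gap ν istar i) -
        ((K + 1) * (64 * (σ + 1) ^ 2 * Real.log T / d ^ 2) + K + 1 + explorations explore ξ T) ≤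
      ∑ i ∈ Finset.univ.erase istar, (counts F B X ξ T i : ℝ) := by
  set L := 64 * (σ + 1) ^ 2 * Real.log T / d ^ 2
  have hℓ : 0 ≤ Real.log T := Real.log_natCast_nonneg T
  have hL0 : 0 ≤ L := by positivity
  have hE := explorations_nonneg explore ξ T
  have hK0 : (0 : ℝ) ≤ K := Nat.cast_nonneg K
  -- If an arm with threshold at least `L` misses it, the optimal arm is rarely pulled and `hT`
  -- bounds the remaining rounds below. Otherwise each suboptimal arm falls short of its threshold
  -- by at most `L`.
  by_cases h : ∃ i, i ≠ istar ∧ L ≤ B i / (2 * gap ν istar i) ∧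
      (counts F B X ξ T i : ℝ) < B i / (2 * gap ν istar i)
  · obtain ⟨i, hi, hL, hN⟩ := h
    have h1 := counts_istar_le hF hσ hd hgap hB hG hi hL hN
    have h2 : ∑ i ∈ Finset.univ.erase istar, (counts F B X ξ T i : ℝ) +
        counts F B X ξ T istar = T := by
      rw [Finset.sum_erase_add _ _ (Finset.mem_univ _)]
      exact_mod_cast sum_counts F B X ξ T
    nlinarith [mul_nonneg hK0 hL0]
  · push Not at h
    have h1 : ∑ i ∈ Finset.univ.erase istar, B i / (2 * gap ν istar i) ≤
        ∑ i ∈ Finset.univ.erase istar, ((counts F B X ξ T i : ℝ) + L) := by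
      refine Finset.sum_le_sum fun i hi => ?_
      have hc : (0 : ℝ) ≤ counts F B X ξ T i := Nat.cast_nonneg _
      rcases le_or_gt L (B i / (2 * gap ν istar i)) with h' | h'
      · linarith [h i (Finset.ne_of_mem_erase hi) h']
      · linarith
    rw [Finset.sum_add_distrib, Finset.sum_const, nsmul_eq_mul] at h1
    have h2 : ((Finset.univ.erase istar).card : ℝ) ≤ K := by
      exact_mod_cast (Finset.card_le_univ _).trans_eq (Fintype.card_fin K)
    nlinarith [mul_le_mul_of_nonneg_right h2 hL0]

end Greedy

end StrategicBandit

/-! ### Two-sided tail bound and independence in product spaces -/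

lemma ProbabilityTheory.HasSubgaussianMGF.measureReal_lt_abs_le {Ω : Type*} [MeasurableSpace Ω]
    {μ : Measure Ω} [IsFiniteMeasure μ] {Y : Ω → ℝ} {c : ℝ≥0} (h : HasSubgaussianMGF Y c μ) {ε : ℝ}
    (hε : 0 ≤ ε) : μ.real {ω | ε < |Y ω|} ≤ 2 * Real.exp (-ε ^ 2 / (2 * c)) := by
  have hsub : {ω | ε < |Y ω|} ⊆ {ω | ε ≤ Y ω} ∪ {ω | ε ≤ (-Y) ω} := by
    intro ω hω
    rcases lt_abs.1 (show ε < |Y ω| from hω) with h | h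
    · exact Or.inl h.le
    · exact Or.inr h.le
  have h1 := h.measure_ge_le hε
  have h2 := h.neg.measure_ge_le hε
  calc μ.real {ω | ε < |Y ω|} ≤ μ.real ({ω | ε ≤ Y ω} ∪ {ω | ε ≤ (-Y) ω}) := measureReal_mono hsub
    _ ≤ _ := measureReal_union_le _ _
    _ ≤ _ := by linarith

/-- Under a product measure, a function that does not depend on the coordinate `p` is independent of
this coordinate. -/
lemma ProbabilityTheory.indepFun_eval_of_update {ι β : Type*} [DecidableEq ι] [MeasurableSpace β]
    {P : ι → Measure ℝ} [∀ i, IsProbabilityMeasure (P i)] {g : (ι → ℝ) → β} (hg : Measurable g)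
    (p : ι) (h : ∀ x, g x = g (Function.update x p 0)) :
    IndepFun (fun x : ι → ℝ => x p) g (Measure.infinitePi P) := by
  have hi : iIndep (fun i : ι => MeasurableSpace.comap (fun x : ι → ℝ => x i) inferInstance)
      (Measure.infinitePi P) :=
    (iIndepFun_infinitePi (P := P) (X := fun _ x => x) fun _ => measurable_id).iIndep
  have hd := indep_iSup_of_disjoint (fun i => (measurable_pi_apply i).comap_le) hi
    (S := {p}) (T := {p}ᶜ) disjoint_compl_right
  -- Resetting coordinate `p` is measurable with respect to the other coordinates, and `g` factors
  -- through it.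
  have hm : Measurable[⨆ i ∈ ({p}ᶜ : Set ι),
      MeasurableSpace.comap (fun x : ι → ℝ => x i) inferInstance]
      fun x : ι → ℝ => Function.update x p 0 := by
    refine @measurable_pi_lambda _ _ _ (_) _ _ fun i => ?_
    by_cases hip : i = p
    · subst hip
      simp only [Function.update_self]
      exact measurable_const
    · simp only [Function.update_of_ne hip]
      refine Measurable.mono (comap_measurable _) ?_ le_rfl
      exact le_iSup₂_of_le i hip le_rfl
  refine indep_of_indep_of_le_left (indep_of_indep_of_le_right hd ?_) ?_
  · have : g = g ∘ fun x => Function.update x p 0 := funext h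
    rw [this]
    exact (hg.comp hm).comap_le
  · exact le_iSup₂_of_le p rfl le_rfl

namespace StrategicBandit

/-! ### Expected regret and probability of atypical outcomes -/

section Probability

variable {K : ℕ} {Seed : Type} [MeasurableSpace Seed]
  {F : Policy K Seed} {explore : ℕ → Set Seed} {w : Seed → Fin K → ℝ}
  {ν : Fin K → Measure ℝ} {ρ : Measure Seed}

instance [∀ i, IsProbabilityMeasure (ν i)] [IsProbabilityMeasure ρ] :
    IsProbabilityMeasure (law ν ρ) := by
  unfold law
  infer_instance

lemma measurePreserving_reward [∀ i, IsProbabilityMeasure (ν i)] [IsProbabilityMeasure ρ]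
    (p : Fin K × ℕ) :
    MeasurePreserving (fun ω : (Fin K × ℕ → ℝ) × (ℕ → Seed) => ω.1 p) (law ν ρ) (ν p.1) :=
  (measurePreserving_eval_infinitePi (fun p : Fin K × ℕ => ν p.1) p).comp measurePreserving_fst

lemma measurePreserving_seed [∀ i, IsProbabilityMeasure (ν i)] [IsProbabilityMeasure ρ]
    (t : ℕ) :
    MeasurePreserving (fun ω : (Fin K × ℕ → ℝ) × (ℕ → Seed) => ω.2 t) (law ν ρ) ρ :=
  (measurePreserving_eval_infinitePi (fun _ : ℕ => ρ) t).comp measurePreserving_snd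

lemma IsPerturbedGreedy.measurable_counts (hF : IsPerturbedGreedy F explore w) (B : Fin K → ℝ)
    (t : ℕ) :
    Measurable fun ω : (Fin K × ℕ → ℝ) × (ℕ → Seed) => counts F B ω.1 ω.2 t := by
  induction t with
  | zero => exact measurable_const
  | succ t ih =>
    have hm : Measurable fun ω : (Fin K × ℕ → ℝ) × (ℕ → Seed) =>
        fun i => lumpMean (B i) (fun s => ω.1 (i, s)) (counts F B ω.1 ω.2 t i) := by
      refine measurable_pi_lambda _ fun i => ?_
      -- Counts take countably many values, so joint measurability can be checked with the count
      -- fixed.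
      have hl : Measurable fun q : ℕ × (ℕ → ℝ) => lumpMean (B i) q.2 q.1 := by
        refine measurable_from_prod_countable_right fun n => ?_
        change Measurable fun x : ℕ → ℝ =>
          (∑ s ∈ Finset.range n, x s + if n = 0 then 0 else B i) / (n : ℝ)
        fun_prop
      exact hl.comp (((measurable_pi_apply i).comp ih).prodMk (by fun_prop))
    have ha : Measurable fun ω : (Fin K × ℕ → ℝ) × (ℕ → Seed) => pulledArm F B ω.1 ω.2 t := by
      have hl : Measurable fun q : (Fin K → ℕ) × ((Fin K → ℝ) × Seed) =>
          F t q.2.1 q.1 q.2.2 :=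
        measurable_from_prod_countable_right fun n => hF.measurable t n
      exact hl.comp (ih.prodMk (hm.prodMk (by fun_prop)))
    refine measurable_pi_lambda _ fun i => ?_
    simp only [counts_succ]
    exact ((measurable_pi_apply i).comp ih).add
      (Measurable.ite (ha (measurableSet_singleton i)) measurable_const measurable_const)

lemma IsPerturbedGreedy.measurableSet_lt_counts (hF : IsPerturbedGreedy F explore w)
    (B : Fin K → ℝ) (t : ℕ) (i : Fin K) (s : ℕ) :
    MeasurableSet {ω : (Fin K × ℕ → ℝ) × (ℕ → Seed) | s < counts F B ω.1 ω.2 t i} :=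
  measurableSet_lt measurable_const ((measurable_pi_apply i).comp (hF.measurable_counts B t))

lemma measurableSet_typical (hw : Measurable w) (ν : Fin K → Measure ℝ) (σ : ℝ) (T : ℕ) :
    MeasurableSet {ω : (Fin K × ℕ → ℝ) × (ℕ → Seed) | Typical ν σ w T ω.1 ω.2} := by
  simp only [Typical, Set.ofPred_and, Set.ofPred_forall]
  refine MeasurableSet.inter ?_ ?_
  · refine MeasurableSet.iInter fun i => MeasurableSet.iInter fun s => MeasurableSet.iInter fun _ => ?_
    exact measurableSet_le (by fun_prop) measurable_const
  · refine MeasurableSet.iInter fun t => MeasurableSet.iInter fun _ => MeasurableSet.iInter fun i => ?_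
    exact measurableSet_le (by fun_prop) measurable_const

lemma integrable_of_hasSubgaussianMGF {i : Fin K} [IsProbabilityMeasure (ν i)] {c : ℝ≥0}
    (h : HasSubgaussianMGF (fun x : ℝ => x - mean ν i) c (ν i)) : Integrable (fun x => x) (ν i) := by
  exact (h.integrable.add (integrable_const (mean ν i))).congr (.of_forall fun x => by simp)

omit [MeasurableSpace Seed] in
/-- The regret as a sum over the rewards that may be pulled. -/
lemma regret_eq_sum (F : Policy K Seed) (B : Fin K → ℝ) (istar : Fin K) (T : ℕ)
    (ω : (Fin K × ℕ → ℝ) × (ℕ → Seed)) :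
    regret ν istar F.principal (fun i => lsi (B i)) T ω =
      ∑ i, ∑ s ∈ Finset.range T,
        {ω : (Fin K × ℕ → ℝ) × (ℕ → Seed) | s < counts F B ω.1 ω.2 T i}.indicator
          (fun ω => mean ν istar - ω.1 (i, s)) ω := by
  rw [show ω = (ω.1, ω.2) from rfl, regret_eq]
  refine Finset.sum_congr rfl fun i _ => ?_
  simp only [Set.indicator_apply, Set.mem_ofPred_eq]
  rw [← Finset.sum_filter]
  refine Finset.sum_congr ?_ fun _ _ => rfl
  ext s
  simp only [Finset.mem_range, Finset.mem_filter]
  have := counts_le F B ω.1 ω.2 T i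
  omega

variable [∀ i, IsProbabilityMeasure (ν i)] [IsProbabilityMeasure ρ]

lemma IsPerturbedGreedy.integrable_indicator (hF : IsPerturbedGreedy F explore w) (B : Fin K → ℝ)
    (istar : Fin K) (T : ℕ) {i : Fin K} (hi : Integrable (fun x => x) (ν i)) (s : ℕ) :
    Integrable ({ω : (Fin K × ℕ → ℝ) × (ℕ → Seed) | s < counts F B ω.1 ω.2 T i}.indicator
      fun ω => mean ν istar - ω.1 (i, s)) (law ν ρ) := by
  refine Integrable.indicator ?_ (hF.measurableSet_lt_counts B T i s)
  refine (integrable_const _).sub ?_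
  exact ((measurePreserving_reward (i, s)).integrable_comp hi.aestronglyMeasurable).2 hi

lemma IsPerturbedGreedy.integrable_regret (hF : IsPerturbedGreedy F explore w) (B : Fin K → ℝ)
    (istar : Fin K) (T : ℕ) (hi : ∀ i, Integrable (fun x => x) (ν i)) :
    Integrable (regret ν istar F.principal (fun i => lsi (B i)) T) (law ν ρ) := by
  rw [show regret ν istar F.principal (fun i => lsi (B i)) T = _ from
    funext (regret_eq_sum F B istar T)]
  exact integrable_finsetSum _ fun i _ => integrable_finsetSum _ fun s _ =>
    hF.integrable_indicator B istar T (hi i) s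

/-- The reward number `s` of an arm is independent of whether it is observed. -/
lemma IsPerturbedGreedy.integral_indicator (hF : IsPerturbedGreedy F explore w) (B : Fin K → ℝ)
    (istar : Fin K) (T : ℕ) {i : Fin K} (hi : Integrable (fun x => x) (ν i)) (s : ℕ) :
    ∫ ω, {ω : (Fin K × ℕ → ℝ) × (ℕ → Seed) | s < counts F B ω.1 ω.2 T i}.indicator
      (fun ω => mean ν istar - ω.1 (i, s)) ω ∂(law ν ρ) =
    ∫ ω, gap ν istar i * {ω : (Fin K × ℕ → ℝ) × (ℕ → Seed) |
      s < counts F B ω.1 ω.2 T i}.indicator 1 ω ∂(law ν ρ) := by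
  classical
  have hms := hF.measurableSet_lt_counts B T i s
  have hint := hF.integrable_indicator (ρ := ρ) B istar T hi s
  have hint' : Integrable (fun ω => gap ν istar i * {ω : (Fin K × ℕ → ℝ) × (ℕ → Seed) |
      s < counts F B ω.1 ω.2 T i}.indicator (1 : (Fin K × ℕ → ℝ) × (ℕ → Seed) → ℝ) ω) (law ν ρ) :=
    ((integrable_const (1 : ℝ)).indicator hms).const_mul _
  unfold law at hint hint' ⊢
  -- Freeze the seeds and integrate over the rewards first: given `ξ`, the event does not depend on
  -- reward `(i, s)`, by `lt_counts_iff`.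
  rw [integral_prod_symm _ hint, integral_prod_symm _ hint']
  refine integral_congr_ae (.of_forall fun ξ => ?_)
  set g : (Fin K × ℕ → ℝ) → ℝ := fun X =>
    {ω : (Fin K × ℕ → ℝ) × (ℕ → Seed) | s < counts F B ω.1 ω.2 T i}.indicator 1 (X, ξ) with hg
  have hgm : Measurable g :=
    (measurable_const.indicator hms).comp (measurable_id.prodMk measurable_const)
  have hind : IndepFun (fun X : Fin K × ℕ → ℝ => X (i, s)) g
      (Measure.infinitePi fun p : Fin K × ℕ => ν p.1) := by
    refine indepFun_eval_of_update hgm (i, s) fun X => ?_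
    have := lt_counts_iff F B ξ (X := X) (X' := Function.update X (i, s) 0) (i := i) (s := s)
      (fun p hp => by rw [Function.update_of_ne hp]) T
    simp only [hg, Set.indicator_apply, Set.mem_ofPred_eq, this, Pi.one_apply]
  have hmp := measurePreserving_eval_infinitePi (fun p : Fin K × ℕ => ν p.1) (i, s)
  have hmean : ∫ X : Fin K × ℕ → ℝ, (mean ν istar - X (i, s))
      ∂(Measure.infinitePi fun p : Fin K × ℕ => ν p.1) = gap ν istar i := by
    have hi' : Integrable (fun X : Fin K × ℕ → ℝ => X (i, s))
        (Measure.infinitePi fun p : Fin K × ℕ => ν p.1) :=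
      (hmp.integrable_comp hi.aestronglyMeasurable).2 hi
    rw [integral_sub (integrable_const _) hi', gap]
    congr 1
    · simp
    · have := integral_map hmp.measurable.aemeasurable (f := fun x : ℝ => x)
        (by rw [hmp.map_eq]; exact hi.aestronglyMeasurable)
      rw [hmp.map_eq] at this
      exact this.symm
  have hprod := (hind.comp (φ := fun x => mean ν istar - x) (ψ := id) (by fun_prop)
    measurable_id).integral_fun_mul_eq_mul_integral
      (Measurable.aestronglyMeasurable (by fun_prop)) (Measurable.aestronglyMeasurable (by fun_prop))
  simp only [Function.comp_def, id] at hprod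
  rw [hmean] at hprod
  change _ = ∫ X, gap ν istar i * g X ∂_
  rw [integral_const_mul, ← hprod]
  refine integral_congr_ae (.of_forall fun X => ?_)
  simp only [hg, Set.indicator_apply, Pi.one_apply]
  split_ifs <;> simp

/-- The regret in terms of the numbers of pulls. -/
lemma IsPerturbedGreedy.integral_regret (hF : IsPerturbedGreedy F explore w) (B : Fin K → ℝ)
    (istar : Fin K) (T : ℕ) (hi : ∀ i, Integrable (fun x => x) (ν i)) :
    ∫ ω, regret ν istar F.principal (fun i => lsi (B i)) T ω ∂(law ν ρ) =
      ∫ ω, ∑ i, gap ν istar i * counts F B ω.1 ω.2 T i ∂(law ν ρ) := by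
  have hint : ∀ i s, Integrable (fun ω => gap ν istar i *
      {ω : (Fin K × ℕ → ℝ) × (ℕ → Seed) | s < counts F B ω.1 ω.2 T i}.indicator (1 : (Fin K × ℕ → ℝ) × (ℕ → Seed) → ℝ) ω)
      (law ν ρ) := fun i s =>
    ((integrable_const (1 : ℝ)).indicator (hF.measurableSet_lt_counts B T i s)).const_mul _
  have hsum : ∀ ω : (Fin K × ℕ → ℝ) × (ℕ → Seed),
      ∑ i, gap ν istar i * (counts F B ω.1 ω.2 T i : ℝ) = ∑ i, ∑ s ∈ Finset.range T,
        gap ν istar i * {ω : (Fin K × ℕ → ℝ) × (ℕ → Seed) |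
          s < counts F B ω.1 ω.2 T i}.indicator 1 ω := by
    intro ω
    refine Finset.sum_congr rfl fun i _ => ?_
    rw [← Finset.mul_sum]
    congr 1
    simp only [Set.indicator_apply, Set.mem_ofPred_eq, Pi.one_apply, Finset.sum_boole]
    congr 1
    rw [show (Finset.range T).filter (fun s => s < counts F B ω.1 ω.2 T i) =
      Finset.range (counts F B ω.1 ω.2 T i) from ?_, Finset.card_range]
    ext s
    simp only [Finset.mem_range, Finset.mem_filter]
    have := counts_le F B ω.1 ω.2 T i
    omega
  simp only [regret_eq_sum, hsum]
  rw [integral_finsetSum _ fun i _ => integrable_finsetSum _ fun s _ =>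
      hF.integrable_indicator B istar T (hi i) s,
    integral_finsetSum _ fun i _ => integrable_finsetSum _ fun s _ => hint i s]
  refine Finset.sum_congr rfl fun i _ => ?_
  rw [integral_finsetSum _ fun s _ => hF.integrable_indicator B istar T (hi i) s,
    integral_finsetSum _ fun s _ => hint i s]
  exact Finset.sum_congr rfl fun s _ => hF.integral_indicator B istar T (hi i) s

lemma integral_explorations (he : ∀ t, MeasurableSet (explore t)) (T : ℕ) :
    Integrable (fun ω => explorations explore ω.2 T) (law ν ρ) ∧
    ∫ ω, explorations explore ω.2 T ∂(law ν ρ) = ∑ t ∈ Finset.range T, ρ.real (explore t) := by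
  have h : ∀ t, (fun ω : (Fin K × ℕ → ℝ) × (ℕ → Seed) =>
      (explore t).indicator (1 : Seed → ℝ) (ω.2 t)) =
      ((fun ω : (Fin K × ℕ → ℝ) × (ℕ → Seed) => ω.2 t) ⁻¹' explore t).indicator 1 :=
    fun t => rfl
  have hm : ∀ t, MeasurableSet
      ((fun ω : (Fin K × ℕ → ℝ) × (ℕ → Seed) => ω.2 t) ⁻¹' explore t) :=
    fun t => (measurePreserving_seed (ν := ν) (ρ := ρ) t).measurable (he t)
  have hi : ∀ t, Integrable (fun ω : (Fin K × ℕ → ℝ) × (ℕ → Seed) =>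
      (explore t).indicator (1 : Seed → ℝ) (ω.2 t)) (law ν ρ) := fun t => by
    rw [h]
    exact (integrable_const (1 : ℝ)).indicator (hm t)
  unfold explorations
  refine ⟨integrable_finsetSum _ fun t _ => hi t, ?_⟩
  rw [integral_finsetSum _ fun t _ => hi t]
  refine Finset.sum_congr rfl fun t _ => ?_
  rw [h, integral_indicator_one (hm t),
    (measurePreserving_seed t).measureReal_preimage (he t).nullMeasurableSet]

/-- Union bound over `K T` reward sums and `K T` noises, each exceeding its width with probability
at most `2 / T²`. Reward sums are taken over fixed initial segments of the table, so the random
numbers of pulls cause no difficulty. -/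
lemma measureReal_not_typical_le {σ : ℝ≥0} (hσ : 0 < σ)
    (hν : ∀ i, HasSubgaussianMGF (fun x : ℝ => x - mean ν i) (σ ^ 2) (ν i))
    (hw : Measurable w) (hρ : ∀ i, HasSubgaussianMGF (fun z => w z i) 1 ρ) {T : ℕ} (hT : 2 ≤ T) :
    T * (law ν ρ).real {ω | Typical ν σ w T ω.1 ω.2}ᶜ ≤ 4 * K := by
  have hT0 : (0 : ℝ) < T := by exact_mod_cast (by omega : 0 < T)
  have hℓ : 0 ≤ Real.log T := Real.log_natCast_nonneg T
  -- The factor 2 in the widths of `Typical` makes every sub-Gaussian exponent equal to `-2 ln T`.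
  have hexp : Real.exp (-(2 * Real.log T)) = (T : ℝ)⁻¹ * (T : ℝ)⁻¹ := by
    rw [show -(2 * Real.log T) = -Real.log T + -Real.log T by ring, Real.exp_add, Real.exp_neg,
      Real.exp_log hT0]
  have hσ' : (0 : ℝ) < σ := hσ
  have hind : ∀ i : Fin K, iIndepFun (fun (s : ℕ) (X : Fin K × ℕ → ℝ) => X (i, s) - mean ν i)
      (Measure.infinitePi fun p : Fin K × ℕ => ν p.1) := fun i =>
    (iIndepFun_infinitePi (P := fun p : Fin K × ℕ => ν p.1) (X := fun p x => x - mean ν p.1)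
      (fun _ => by fun_prop)).precomp (g := fun s : ℕ => (i, s)) (Prod.mk_right_injective i)
  have h1 : ∀ i, ∀ s ∈ Finset.Icc 1 T, (law ν ρ).real {ω | 2 * σ * √(s * Real.log T) <
      |∑ k ∈ Finset.range s, ω.1 (i, k) - s * mean ν i|} ≤ 2 * ((T : ℝ)⁻¹ * (T : ℝ)⁻¹) := by
    intro i s hs
    have hs0 : (0 : ℝ) < s := by exact_mod_cast (Finset.mem_Icc.1 hs).1
    have hsub := HasSubgaussianMGF.sum_of_iIndepFun (hind i) (c := fun _ => σ ^ 2)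
      (s := Finset.range s) fun k _ => HasSubgaussianMGF.of_map (Y := fun X : Fin K × ℕ → ℝ => X (i, k))
        (X := fun x => x - mean ν i) (measurable_pi_apply _).aemeasurable
        (by
          rw [show (fun X : Fin K × ℕ → ℝ => X (i, k)) = Function.eval (i, k) from rfl,
            (measurePreserving_eval_infinitePi (fun p : Fin K × ℕ => ν p.1) (i, k)).map_eq]
          exact hν i)
    have hle := hsub.measureReal_lt_abs_le (ε := 2 * σ * √(s * Real.log T)) (by positivity)
    have hpre := (measurePreserving_fst (μ := Measure.infinitePi fun p : Fin K × ℕ => ν p.1)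
      (ν := Measure.infinitePi fun _ : ℕ => ρ)).measureReal_preimage
      (s := {X | 2 * σ * √(s * Real.log T) < |∑ k ∈ Finset.range s, (X (i, k) - mean ν i)|})
      (measurableSet_lt measurable_const (by fun_prop)).nullMeasurableSet
    rw [← hpre] at hle
    simp only [Finset.sum_sub_distrib, Finset.sum_const, Finset.card_range, nsmul_eq_mul,
      Set.preimage_ofPred_eq] at hle
    refine hle.trans_eq ?_
    rw [← hexp]
    congr 2
    push_cast
    rw [mul_pow, mul_pow, Real.sq_sqrt (by positivity)]
    field_simp
  have h2 : ∀ t i, (law ν ρ).real {ω | 2 * √(Real.log T) < |w (ω.2 t) i|} ≤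
      2 * ((T : ℝ)⁻¹ * (T : ℝ)⁻¹) := by
    intro t i
    have hle := (hρ i).measureReal_lt_abs_le (ε := 2 * √(Real.log T)) (by positivity)
    rw [← (measurePreserving_seed (ν := ν) t).measureReal_preimage
      (measurableSet_lt measurable_const (by fun_prop)).nullMeasurableSet,
      Set.preimage_ofPred_eq] at hle
    refine hle.trans_eq ?_
    rw [← hexp]
    congr 2
    rw [mul_pow, Real.sq_sqrt hℓ]
    push_cast
    ring
  have hsub : {ω : (Fin K × ℕ → ℝ) × (ℕ → Seed) | Typical ν σ w T ω.1 ω.2}ᶜ ⊆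
      (⋃ i ∈ (Finset.univ : Finset (Fin K)), ⋃ s ∈ Finset.Icc 1 T,
        {ω | 2 * σ * √(s * Real.log T) <
          |∑ k ∈ Finset.range s, ω.1 (i, k) - s * mean ν i|}) ∪
      ⋃ t ∈ Finset.range T, ⋃ i ∈ (Finset.univ : Finset (Fin K)),
        {ω | 2 * √(Real.log T) < |w (ω.2 t) i|} := by
    intro ω hω
    contrapose! hω
    simp only [Set.mem_union, Set.mem_iUnion, Set.mem_ofPred_eq, not_or, not_exists, not_lt,
      Finset.mem_univ, exists_prop, true_and, not_and] at hω
    simp only [Set.mem_compl_iff, not_not, Set.mem_ofPred_eq, Typical]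
    exact hω
  have hle : (law ν ρ).real {ω | Typical ν σ w T ω.1 ω.2}ᶜ ≤
      4 * K * T * ((T : ℝ)⁻¹ * (T : ℝ)⁻¹) := by
    refine (measureReal_mono hsub).trans ((measureReal_union_le _ _).trans ?_)
    have e1 := (measureReal_biUnion_finset_le (μ := law ν ρ) Finset.univ fun i : Fin K =>
      ⋃ s ∈ Finset.Icc 1 T, {ω | 2 * σ * √(s * Real.log T) <
          |∑ k ∈ Finset.range s, ω.1 (i, k) - s * mean ν i|}).trans
      (Finset.sum_le_sum fun i _ => (measureReal_biUnion_finset_le _ _).trans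
        (Finset.sum_le_sum fun s hs => h1 i s hs))
    have e2 := (measureReal_biUnion_finset_le (μ := law ν ρ) (Finset.range T) fun t =>
      ⋃ i ∈ (Finset.univ : Finset (Fin K)), {ω | 2 * √(Real.log T) < |w (ω.2 t) i|}).trans
      (Finset.sum_le_sum fun t _ => (measureReal_biUnion_finset_le _ _).trans
        (Finset.sum_le_sum fun i _ => h2 t i))
    simp only [Finset.sum_const, Finset.card_univ, Fintype.card_fin, nsmul_eq_mul, Nat.card_Icc,
      Finset.card_range, Nat.add_sub_cancel] at e1 e2
    linarith
  calc T * (law ν ρ).real {ω | Typical ν σ w T ω.1 ω.2}ᶜ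
      ≤ T * (4 * K * T * ((T : ℝ)⁻¹ * (T : ℝ)⁻¹)) := by gcongr
    _ = 4 * K := by field_simp

/-- The regret bound for perturbed greedy policies against lump sum investing. -/
theorem IsPerturbedGreedy.le_integral_regret (hF : IsPerturbedGreedy F explore w) {σ : ℝ≥0}
    (hσ : 0 < σ) (hν : ∀ i, HasSubgaussianMGF (fun x : ℝ => x - mean ν i) (σ ^ 2) (ν i))
    (hρ : ∀ i, HasSubgaussianMGF (fun z => w z i) 1 ρ) {istar : Fin K} {d : ℝ} (hd : 0 < d)
    (hgap : ∀ i, i ≠ istar → d ≤ gap ν istar i) {B : Fin K → ℝ} (hB : B istar = 0)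
    {T : ℕ} (hT2 : 2 ≤ T) (hT : ∑ i ∈ Finset.univ.erase istar, B i / (2 * gap ν istar i) ≤ T) :
    d * ∑ i ∈ Finset.univ.erase istar, B i / (2 * gap ν istar i) -
        d * ((K + 1) * (64 * (σ + 1) ^ 2 * Real.log T / d ^ 2) + 5 * K + 1 +
          ∑ t ∈ Finset.range T, ρ.real (explore t)) ≤
      ∫ ω, regret ν istar F.principal (fun i => lsi (B i)) T ω ∂(law ν ρ) := by
  have hℓ : 0 ≤ Real.log T := Real.log_natCast_nonneg T
  rw [hF.integral_regret B istar T fun i => integrable_of_hasSubgaussianMGF (hν i)]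
  set N := ∑ i ∈ Finset.univ.erase istar, B i / (2 * gap ν istar i)
  set L := 64 * ((σ : ℝ) + 1) ^ 2 * Real.log T / d ^ 2
  have hL0 : 0 ≤ L := by positivity
  have hmt := (measurableSet_typical (Seed := Seed) hF.measurable_noise ν σ T).compl
  obtain ⟨hei, hee⟩ := integral_explorations (ν := ν) (ρ := ρ) hF.measurableSet_explore T
  have hpt : ∀ ω : (Fin K × ℕ → ℝ) × (ℕ → Seed),
      d * (N - ((K + 1) * L + K + 1) - explorations explore ω.2 T -
        T * {ω | Typical ν σ w T ω.1 ω.2}ᶜ.indicator 1 ω) ≤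
        ∑ i, gap ν istar i * counts F B ω.1 ω.2 T i := by
    intro ω
    have hsum : d * ∑ i ∈ Finset.univ.erase istar, (counts F B ω.1 ω.2 T i : ℝ) ≤
        ∑ i, gap ν istar i * counts F B ω.1 ω.2 T i := by
      rw [← Finset.sum_erase_add _ _ (Finset.mem_univ istar), Finset.mul_sum]
      simp only [gap, sub_self, zero_mul, add_zero]
      exact Finset.sum_le_sum fun i hi => mul_le_mul_of_nonneg_right
        (hgap i (Finset.ne_of_mem_erase hi)) (Nat.cast_nonneg _)
    refine le_trans (mul_le_mul_of_nonneg_left ?_ hd.le) hsum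
    have hE := explorations_nonneg explore ω.2 T
    have hcs : (0 : ℝ) ≤ ∑ i ∈ Finset.univ.erase istar, (counts F B ω.1 ω.2 T i : ℝ) :=
      Finset.sum_nonneg fun _ _ => Nat.cast_nonneg _
    have hKL : 0 ≤ ((K : ℝ) + 1) * L + K + 1 := by positivity
    by_cases hG : Typical ν σ w T ω.1 ω.2
    · rw [Set.indicator_of_notMem (by simpa using hG)]
      have := le_suboptimal_pulls hF σ.2 hd hgap hB hG hT
      simp only [NNReal.val_eq_coe] at this
      linarith
    -- On an atypical outcome the subtracted `T` outweighs `N ≤ T`, so the left side is at most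
    -- zero.
    · rw [Set.indicator_of_mem (by simpa using hG), Pi.one_apply]
      linarith
  have hit : Integrable (fun ω => T * {ω : (Fin K × ℕ → ℝ) × (ℕ → Seed) |
      Typical ν σ w T ω.1 ω.2}ᶜ.indicator (1 : (Fin K × ℕ → ℝ) × (ℕ → Seed) → ℝ) ω) (law ν ρ) :=
    ((integrable_const (1 : ℝ)).indicator hmt).const_mul _
  have hic : Integrable (fun ω => ∑ i, gap ν istar i * (counts F B ω.1 ω.2 T i : ℝ))
      (law ν ρ) := by
    refine integrable_finsetSum _ fun i _ => Integrable.const_mul ?_ _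
    refine Integrable.of_bound (C := T) (Measurable.aestronglyMeasurable ?_) (.of_forall fun ω => ?_)
    · exact measurable_from_nat.comp ((measurable_pi_apply i).comp (hF.measurable_counts B T))
    · simpa using counts_le F B ω.1 ω.2 T i
  have h1 := (integrable_const (μ := law ν ρ) (N - ((K + 1) * L + K + 1))).sub hei
  have hmono := integral_mono ((h1.sub hit).const_mul d) hic hpt
  rw [integral_const_mul, integral_sub' h1 hit, integral_sub' (integrable_const _) hei, hee,
    integral_const_mul, integral_indicator_one hmt, integral_const, probReal_univ,
    one_smul] at hmono
  refine le_trans ?_ hmono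
  rw [← mul_sub]
  refine mul_le_mul_of_nonneg_left ?_ hd.le
  -- Adds `4K` to the `K` from the initial rounds, hence `5K`.
  have := measureReal_not_typical_le hσ hν hF.measurable_noise hρ hT2
  linarith

end Probability

end StrategicBandit

namespace StrategicBandit

/-! ### The two algorithms as perturbed greedy policies -/

section Algorithms

variable {K : ℕ}

lemma minGap_le (ν : Fin K → Measure ℝ) {istar i : Fin K} (hi : i ≠ istar) :
    minGap ν istar ≤ gap ν istar i :=
  ciInf_le (f := fun i : {i : Fin K // i ≠ istar} => gap ν istar i)
    (Set.finite_range _).bddBelow ⟨i, hi⟩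

lemma minGap_pos (hK : 2 ≤ K) {ν : Fin K → Measure ℝ} {istar : Fin K}
    (h : ∀ i, i ≠ istar → mean ν i < mean ν istar) : 0 < minGap ν istar := by
  have : Nontrivial (Fin K) := Fin.nontrivial_iff_two_le.2 hK
  have : Nonempty {i : Fin K // i ≠ istar} := nonempty_subtype.2 (exists_ne istar)
  obtain ⟨i, hi⟩ := exists_eq_ciInf_of_finite (f := fun i : {i : Fin K // i ≠ istar} =>
    gap ν istar i)
  rw [minGap, ← hi]
  exact sub_pos.2 (h i i.2)

/-- The policy of the `ε`-greedy algorithm. -/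
noncomputable def epsPolicy (ε : ℕ → ℝ) (sel : ℕ → (Fin K → ℝ) → Fin K) :
    Policy K (ℝ × Fin K) :=
  fun t m _ ξ =>
    if hK : t < K then ⟨t, hK⟩ else if ξ.1 < ε (t + 1) then ξ.2 else sel (t + 1) m

lemma epsGreedy_eq (ε : ℕ → ℝ) (sel : ℕ → (Fin K → ℝ) → Fin K) :
    epsGreedy ε sel = (epsPolicy ε sel).principal := rfl

/-- The shift to `ε (t + 1)` reflects that after `t` rounds the policy decides round `t + 1`. -/
lemma isPerturbedGreedy_epsPolicy (ε : ℕ → ℝ) {sel : ℕ → (Fin K → ℝ) → Fin K}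
    (hsel : IsArgmaxRule sel) :
    IsPerturbedGreedy (epsPolicy ε sel) (fun t => {ξ | ξ.1 < ε (t + 1)}) fun _ _ => 0 where
  measurable t n := by
    unfold epsPolicy
    by_cases h : t < K
    · simp only [h, dite_true]
      exact measurable_const
    · simp only [h, dite_false]
      exact Measurable.ite (measurableSet_lt (by fun_prop) measurable_const) (by fun_prop)
        ((hsel.measurable _).comp measurable_fst)
  measurable_noise := measurable_const
  measurableSet_explore t := measurableSet_lt measurable_fst measurable_const
  init t h m n z := by simp [epsPolicy, h]
  le_index t m n z h hz j := by
    have : ¬ z.1 < ε (t + 1) := hz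
    simp only [epsPolicy, not_lt.2 h, dite_false, this, if_false, zero_div, add_zero]
    exact hsel.le_sel _ m j

/-- The policy of Gaussian Thompson sampling. -/
noncomputable def thompsonPolicy (sel : ℕ → (Fin K → ℝ) → Fin K) : Policy K (Fin K → ℝ) :=
  fun t m n z =>
    if hK : t < K then ⟨t, hK⟩ else sel (t + 1) fun i => m i + z i / √(n i : ℝ)

lemma thompson_eq (sel : ℕ → (Fin K → ℝ) → Fin K) :
    thompson sel = (thompsonPolicy sel).principal := rfl

lemma isPerturbedGreedy_thompsonPolicy {sel : ℕ → (Fin K → ℝ) → Fin K}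
    (hsel : IsArgmaxRule sel) :
    IsPerturbedGreedy (thompsonPolicy sel) (fun _ => ∅) id where
  measurable t n := by
    unfold thompsonPolicy
    by_cases h : t < K
    · simp only [h, dite_true]
      exact measurable_const
    · simp only [h, dite_false]
      exact (hsel.measurable _).comp (by fun_prop)
  measurable_noise := measurable_id
  measurableSet_explore _ := MeasurableSet.empty
  init t h m n z := by simp [thompsonPolicy, h]
  le_index t m n z h _ j := by
    simp only [thompsonPolicy, not_lt.2 h, dite_false, id]
    exact hsel.le_sel (t + 1) (fun i => m i + z i / √(n i : ℝ)) j

lemma hasSubgaussianMGF_thompsonSeed (i : Fin K) :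
    HasSubgaussianMGF (fun z : Fin K → ℝ => id z i) 1 (thompsonSeed K) := by
  have hg : HasSubgaussianMGF (fun x : ℝ => x) 1 (gaussianReal 0 1) :=
    ⟨fun t => integrable_exp_mul_gaussianReal t, fun t => by
      rw [mgf_gaussianReal (X := fun x : ℝ => x) Measure.map_id' t]
      simp⟩
  refine HasSubgaussianMGF.of_map (Y := fun z : Fin K → ℝ => z i) (X := fun x => x)
    (measurable_pi_apply i).aemeasurable ?_
  rw [thompsonSeed, show (fun z : Fin K → ℝ => z i) = Function.eval i from rfl,
    (measurePreserving_eval (fun _ : Fin K => gaussianReal 0 1) i).map_eq]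
  exact hg

instance : IsProbabilityMeasure (thompsonSeed K) := by
  unfold thompsonSeed
  infer_instance

instance : IsProbabilityMeasure (volume.restrict (Set.Icc (0 : ℝ) 1)) :=
  ⟨by simp⟩

lemma isProbabilityMeasure_epsGreedySeed (hK : 0 < K) :
    IsProbabilityMeasure (epsGreedySeed K) := by
  have : Nonempty (Fin K) := ⟨⟨0, hK⟩⟩
  have : IsProbabilityMeasure (uniformOn (Set.univ : Set (Fin K))) :=
    isProbabilityMeasure_uniformOn Set.finite_univ Set.univ_nonempty
  unfold epsGreedySeed
  infer_instance

lemma epsGreedySeed_lt_le (hK : 0 < K) {e : ℝ} (he : 0 ≤ e) :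
    (epsGreedySeed K).real {ξ | ξ.1 < e} ≤ e := by
  have : Nonempty (Fin K) := ⟨⟨0, hK⟩⟩
  have : IsProbabilityMeasure (uniformOn (Set.univ : Set (Fin K))) :=
    isProbabilityMeasure_uniformOn Set.finite_univ Set.univ_nonempty
  have h := (measurePreserving_fst (μ := volume.restrict (Set.Icc (0 : ℝ) 1))
    (ν := uniformOn (Set.univ : Set (Fin K)))).measureReal_preimage (s := Set.Iio e)
    measurableSet_Iio.nullMeasurableSet
  change (epsGreedySeed K).real {ξ | ξ.1 < e} = _ at h
  rw [h, measureReal_restrict_apply measurableSet_Iio]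
  calc volume.real (Set.Iio e ∩ Set.Icc 0 1) ≤ volume.real (Set.Icc 0 e) :=
        measureReal_mono (fun x hx => ⟨hx.2.1, le_of_lt hx.1⟩) (by simp)
    _ = e := by simp [he]

lemma sum_epsSchedule_le {σ d : ℝ} {T : ℕ} (hT : 2 ≤ T) :
    ∑ t ∈ Finset.range T, epsSchedule K σ d (t + 1) ≤
      max 20 (36 * σ ^ 2 / d) * K * (3 * Real.log T) := by
  have hc : 0 ≤ max 20 (36 * σ ^ 2 / d) * (K : ℝ) := by positivity
  -- Since `T ≥ 2`, this absorbs the 1 of the harmonic bound: `1 + ln T ≤ 3 ln T`.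
  have hℓ : 1 ≤ 2 * Real.log T := by
    have := Real.log_le_log two_pos (show (2 : ℝ) ≤ T by exact_mod_cast hT)
    linarith [Real.log_two_gt_d9]
  have hH : ∑ t ∈ Finset.range T, ((t + 1 : ℕ) : ℝ)⁻¹ ≤ 1 + Real.log T := by
    have := harmonic_le_one_add_log T
    simpa [harmonic] using this
  calc ∑ t ∈ Finset.range T, epsSchedule K σ d (t + 1)
      ≤ ∑ t ∈ Finset.range T, max 20 (36 * σ ^ 2 / d) * K * ((t + 1 : ℕ) : ℝ)⁻¹ :=
        Finset.sum_le_sum fun t _ => (min_le_right _ _).trans_eq (div_eq_mul_inv _ _)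
    _ = max 20 (36 * σ ^ 2 / d) * K * ∑ t ∈ Finset.range T, ((t + 1 : ℕ) : ℝ)⁻¹ :=
        (Finset.mul_sum _ _ _).symm
    _ ≤ _ := mul_le_mul_of_nonneg_left (by linarith) hc

/-- After multiplication by `d` every term must be bounded by a multiple of `ln T`. The bound `d ≤
M` controls the constant terms (with `1 ≤ 2 ln T`) and `d²` times the exploration constant, in which
`1 / d` cancels. -/
lemma loss_le {σ d M S : ℝ} {T : ℕ} (hT : 2 ≤ T) (hd : 0 < d) (hdM : d ≤ M)
    (hS : S ≤ max 20 (36 * σ ^ 2 / d) * K * (3 * Real.log T)) :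
    d * ((K + 1) * (64 * (σ + 1) ^ 2 * Real.log T / d ^ 2) + 5 * K + 1 + S) ≤
      ((K + 1) * (64 * (σ + 1) ^ 2) + (5 * K + 1) * (2 * M ^ 2) +
        3 * K * (20 * M ^ 2 + 36 * σ ^ 2 * M)) * (Real.log T / d) := by
  have hℓ : 1 ≤ 2 * Real.log T := by
    have := Real.log_le_log two_pos (show (2 : ℝ) ≤ T by exact_mod_cast hT)
    linarith [Real.log_two_gt_d9]
  set ℓ := Real.log T
  have hℓ0 : 0 ≤ ℓ := by linarith
  have hM : 0 < M := hd.trans_le hdM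
  have hK : (0 : ℝ) ≤ K := Nat.cast_nonneg K
  have hsq : d ^ 2 ≤ M ^ 2 := by gcongr
  have hmax : d ^ 2 * max 20 (36 * σ ^ 2 / d) ≤ 20 * M ^ 2 + 36 * σ ^ 2 * M := by
    rw [mul_max_of_nonneg _ _ (by positivity)]
    refine max_le (by nlinarith [mul_nonneg (sq_nonneg σ) hM.le]) ?_
    have : d ^ 2 * (36 * σ ^ 2 / d) = 36 * σ ^ 2 * d := by field_simp
    rw [this]
    nlinarith [mul_le_mul_of_nonneg_left hdM (sq_nonneg σ), sq_nonneg M]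
  rw [← mul_div_assoc _ (Real.log T) d, le_div_iff₀ hd]
  have e1 : d * ((K + 1) * (64 * (σ + 1) ^ 2 * ℓ / d ^ 2) + 5 * K + 1 + S) * d =
      (K + 1) * (64 * (σ + 1) ^ 2) * ℓ + (5 * K + 1) * d ^ 2 + d ^ 2 * S := by
    field_simp
    ring
  have e2 : (5 * (K : ℝ) + 1) * d ^ 2 ≤ (5 * K + 1) * (2 * M ^ 2) * ℓ := by
    have : d ^ 2 ≤ (2 * M ^ 2) * ℓ := by nlinarith [sq_nonneg M]
    nlinarith
  have e3 : d ^ 2 * S ≤ 3 * K * (20 * M ^ 2 + 36 * σ ^ 2 * M) * ℓ := by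
    calc d ^ 2 * S ≤ d ^ 2 * (max 20 (36 * σ ^ 2 / d) * K * (3 * ℓ)) := by gcongr
      _ = (d ^ 2 * max 20 (36 * σ ^ 2 / d)) * (3 * K * ℓ) := by ring
      _ ≤ (20 * M ^ 2 + 36 * σ ^ 2 * M) * (3 * K * ℓ) := by gcongr
      _ = _ := by ring
  rw [e1]
  linarith

end Algorithms

end StrategicBandit

/-! ### The regret bound for both algorithms -/

theorem proposition1 (K : ℕ) (hK : 2 ≤ K) (σ : ℝ≥0) (hσ : 0 < σ) (M : ℝ) :
    ∃ C : ℝ, ∀ (ν : Fin K → Measure ℝ) (_ : ∀ i, IsProbabilityMeasure (ν i))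
      (_ : ∀ i, HasSubgaussianMGF (fun x : ℝ => x - mean ν i) (σ ^ 2) (ν i))
      (istar : Fin K) (_ : ∀ i, i ≠ istar → mean ν i < mean ν istar)
      (_ : minGap ν istar ≤ M)
      (B : Fin K → ℝ) (_ : ∀ i, 0 ≤ B i) (_ : B istar = 0)
      (T : ℕ) (_ : 2 ≤ T)
      (_ : ∑ i ∈ Finset.univ.erase istar, B i / (2 * gap ν istar i) ≤ T)
      (sel : ℕ → (Fin K → ℝ) → Fin K) (_ : IsArgmaxRule sel),
      -- the principal runs `ε`-greedy
      (Integrable (regret ν istar (epsGreedy (epsSchedule K σ (minGap ν istar)) sel)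
          (fun i => lsi (B i)) T) (law ν (epsGreedySeed K)) ∧
        minGap ν istar * ∑ i ∈ Finset.univ.erase istar, B i / (2 * gap ν istar i)
            - C * (Real.log T / minGap ν istar)
          ≤ ∫ ω, regret ν istar (epsGreedy (epsSchedule K σ (minGap ν istar)) sel)
              (fun i => lsi (B i)) T ω ∂(law ν (epsGreedySeed K))) ∧
      -- the principal runs Gaussian Thompson sampling
      (Integrable (regret ν istar (thompson sel) (fun i => lsi (B i)) T)
          (law ν (thompsonSeed K)) ∧
        minGap ν istar * ∑ i ∈ Finset.univ.erase istar, B i / (2 * gap ν istar i)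
            - C * (Real.log T / minGap ν istar)
          ≤ ∫ ω, regret ν istar (thompson sel) (fun i => lsi (B i)) T ω
              ∂(law ν (thompsonSeed K))) := by
  refine ⟨(K + 1) * (64 * (σ + 1) ^ 2) + (5 * K + 1) * (2 * M ^ 2) +
    3 * K * (20 * M ^ 2 + 36 * σ ^ 2 * M), ?_⟩
  intro ν hprob hν istar hbest hM B _ hB T hT2 hT sel hsel
  have hd := minGap_pos hK hbest
  have hgap : ∀ i, i ≠ istar → minGap ν istar ≤ gap ν istar i := fun i => minGap_le ν
  have hint := fun i => integrable_of_hasSubgaussianMGF (hν i)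
  have := isProbabilityMeasure_epsGreedySeed (show 0 < K by omega)
  have hcount : ∀ t, 0 ≤ epsSchedule K σ (minGap ν istar) t := fun t => by
    unfold epsSchedule
    positivity
  refine ⟨⟨?_, ?_⟩, ?_, ?_⟩
  · rw [epsGreedy_eq]
    exact (isPerturbedGreedy_epsPolicy _ hsel).integrable_regret B istar T hint
  · rw [epsGreedy_eq]
    refine le_trans (sub_le_sub_left (loss_le hT2 hd hM
      ((Finset.sum_le_sum fun t _ => ?_).trans (sum_epsSchedule_le hT2))) _)
      ((isPerturbedGreedy_epsPolicy _ hsel).le_integral_regret hσ hν (fun i => ?_) hd hgap hB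
        hT2 hT)
    · exact epsGreedySeed_lt_le (by omega) (hcount (t + 1))
    -- The noise of `ε`-greedy is zero, hence trivially sub-Gaussian.
    · exact ⟨fun t => by simp, fun t => by simp [mgf]; positivity⟩
  · rw [thompson_eq]
    exact (isPerturbedGreedy_thompsonPolicy hsel).integrable_regret B istar T hint
  · rw [thompson_eq]
    refine le_trans (sub_le_sub_left (loss_le hT2 hd hM ?_) _)
      ((isPerturbedGreedy_thompsonPolicy hsel).le_integral_regret hσ hν
        hasSubgaussianMGF_thompsonSeed hd hgap hB hT2 hT)
    -- Thompson sampling never explores, so `S = 0` in `loss_le`.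
    have := Real.log_natCast_nonneg T
    simp only [measureReal_empty, Finset.sum_const_zero]
    positivity
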